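/- **Model.** Let $N$ (students), $M$ (colleges) and $F$ (features) be finite sets. An instance consists of capacities $x_c\in\mathbb{Z}_{>0}$ ($c\in M$), a strict total order $\succ_c$ on $N$ for each $c\in M$, and, for each student $s\in N$, utility functions $u_s=(u_s^f)_{f\in F}$, $u_s^f:M\to[0,1]$, and a probability distribution $\mu_s$ on the weight vectors $\{w\in\mathbb{R}_{\ge 0}^F:\sum_f w^f=1\}$. Given $w$, student $s$ has $c\succeq_s^{w}c'$ iff $\sum_f w^fu_s^f(c)\ge\sum_f w^fu_s^f(c')$, with strict part $\succ_s^w$; every college is strictly better than being unmatched ($\mathsf{null}$). Probabilities $\Pr[\cdot]$ are over $w\sim\mu_s$. **GDA.** Generalized student-proposing deferred acceptance starts with all students unmatched and $R_s=\emptyset$ for all $s$, where $R_s$ is the set of colleges that have rejected $s$. While some unmatched student has $R_s\ne M$, all such students simultaneously propose, $s$ to the college $\mathsf{Next}(s,R_s,u_s,\mu_s)\notin R_s$; each college $c$ keeps its $x_c$ most preferred students (all, if there are at most $x_c$) among its current students and its new proposers, and rejects the others, who become (or stay) unmatched and add $c$ to their $R_s$. The output is the final matching. **LOICV.** For $c\in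 M\setminus R$ let $\tilde q_s(c,R)$ be the vector of the probabilities $\Pr[c\succeq_s^{w}c']$, $c'\in M\setminus R$, $c'\neq c$, arranged in ascending order. The LOICV rule lets $\mathsf{Next}(s,R,u_s,\mu_s)$ be a college $c\in M\setminus R$ for which $\tilde q_s(c,R)$ is lexicographically maximal among the colleges of $M\setminus R$, ties being broken in any predetermined way (which may depend on $s,R,u_s,\mu_s$). **Theorem.** If $|F|=2$, then GDA with the LOICV rule, with any such tie-breaking, is incentive compatible with rationality (IC-R): for every instance, every student $s$, and every misreport $(u_s',\mu_s')$, if $\pi(s)\in M\cup\{\mathsf{null}\}$ is the assignment of $s$ when she reports $(u_s,\mu_s)$ and $\pi'(s)\in M\cup\{\mathsf{null}\}$ is her assignment when she reports $(u'_s,\mu'_s)$, all else unchanged, then $$\Pr_{w\sim\mu_s}\big[\pi'(s)\succ_s^{w}\pi(s)\big]\le \tfrac12,$$ where $\succ_s^w$ is defined from the true utilities $u_s$. -/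

import Mathlib

namespace SchoolChoice

open MeasureTheory

/-- Weight vectors: nonnegative vectors indexed by the features, with sum `1`. -/
abbrev Weights (F : Type*) [Fintype F] : Type _ := stdSimplex ℝ F

/-- The utility functions of one student: one function from colleges to `[0,1]` per feature. -/
abbrev Utilities (M F : Type*) : Type _ := F → M → Set.Icc (0 : ℝ) 1

/-- An instance of school choice with feature-based uncertain preferences, with students `N`,
colleges `M` and features `F`. -/
structure Instance (N M F : Type*) [Fintype F] where
  /-- capacities of the colleges -/
  capacity : M → ℕ
  capacity_pos : ∀ c, 0 < capacity c
  /-- `prefers c s s'`: college `c` strictly prefers student `s` to student `s'` -/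
  prefers : M → N → N → Prop
  prefers_strict : ∀ c, IsStrictTotalOrder N (prefers c)
  /-- the utility functions of each student -/
  utility : N → Utilities M F
  /-- the weight distribution of each student -/
  dist : N → ProbabilityMeasure (Weights F)

section Preferences

variable {M F : Type*} [Fintype F]

/-- The weighted utility of college `c` under the weight vector `w`. -/
def weightedUtility (u : Utilities M F) (w : Weights F) (c : M) : ℝ :=
  ∑ f, (w : F → ℝ) f * (u f c : ℝ)

/-- The probability that college `c` is weakly preferred to college `c'`. -/
noncomputable def probWeaklyPrefers (u : Utilities M F) (μ : ProbabilityMeasure (Weights F))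
    (c c' : M) : ℝ :=
  (μ : Measure (Weights F)).real {w | weightedUtility u w c' ≤ weightedUtility u w c}

/-- Strict preference between assignments under the weight vector `w`, where `none` means being
unmatched. Every college is acceptable, so it is strictly better than being unmatched. -/
def StrictlyBetter (u : Utilities M F) (w : Weights F) : Option M → Option M → Prop
  | some c, some c' => weightedUtility u w c' < weightedUtility u w c
  | some _, none => True
  | none, _ => False

end Preferences

section Algorithms

variable {N M F : Type*} [Fintype F]

/-- A matching, given by the college of each student (`none` for an unmatched student). -/
abbrev Matching (N M : Type*) : Type _ := N → Option M

open Classical in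
/-- The instance after student `s` replaces her report by the utilities `u'` and the weight
distribution `μ'`. -/
noncomputable def Instance.misreport (I : Instance N M F) (s : N) (u' : Utilities M F)
    (μ' : ProbabilityMeasure (Weights F)) : Instance N M F :=
  { I with
    utility := Function.update I.utility s u'
    dist := Function.update I.dist s μ' }

/-- Incentive compatibility with rationality: in no instance can a student, by misreporting her
utilities and her weight distribution, obtain a college that is strictly better than her truthful
assignment with probability (under her true utilities and weight distribution) more than `1/2`. -/
def IsICR (Alg : Instance N M F → Matching N M) : Prop :=
  ∀ (I : Instance N M F) (s : N) (u' : Utilities M F) (μ' : ProbabilityMeasure (Weights F)),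
    ¬ (1 / 2 < (I.dist s : Measure (Weights F)).real
      {w | StrictlyBetter (I.utility s) w (Alg (I.misreport s u' μ') s) (Alg I s)})

end Algorithms

section DeferredAcceptance

variable {N M F : Type*} [Fintype N] [Fintype M] [Fintype F]

/-- A rule `Next(s, R, u, μ)` giving the college to which student `s` proposes when `R` is the set
of colleges that have rejected her. It is only consulted for `R ≠ univ`. -/
abbrev NextRule (N M F : Type*) [Fintype F] : Type _ :=
  N → Finset M → Utilities M F → ProbabilityMeasure (Weights F) → Option M

/-- The state of generalized deferred acceptance between two rounds. -/
structure GDAState (N M : Type*) where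
  /-- the current matching -/
  matching : Matching N M
  /-- for each student, the set of colleges that have rejected her -/
  rejected : N → Finset M

/-- Before the first round, nobody is matched and nobody has been rejected. -/
def GDAState.init (N M : Type*) : GDAState N M := ⟨fun _ => none, fun _ => ∅⟩

/-- A student proposes in the coming round iff she is unmatched and some college has not yet
rejected her. -/
def GDAState.Active (σ : GDAState N M) (s : N) : Prop :=
  σ.matching s = none ∧ σ.rejected s ≠ Finset.univ

open Classical in
/-- The college that holds or receives the application of `s` in the coming round, if any: her
current college if she is matched, the college she proposes to if she is active. -/
noncomputable def GDAState.applied (next : NextRule N M F) (I : Instance N M F)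
    (σ : GDAState N M) (s : N) : Option M :=
  if σ.Active s then next s (σ.rejected s) (I.utility s) (I.dist s) else σ.matching s

open Classical in
/-- Student `s` is among the `capacity c` most preferred students for college `c` within the set of
students currently matched with or proposing to `c` (all of them if they do not exceed the
capacity). -/
def GDAState.Accepted (next : NextRule N M F) (I : Instance N M F) (σ : GDAState N M)
    (c : M) (s : N) : Prop :=
  σ.applied next I s = some c ∧
    (Finset.univ.filter
      (fun s' => σ.applied next I s' = some c ∧ I.prefers c s' s)).card < I.capacity c

open Classical in
/-- One round: all active students propose simultaneously, each college keeps its most preferred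
students up to its capacity, and rejects the others. -/
noncomputable def GDAState.round (next : NextRule N M F) (I : Instance N M F)
    (σ : GDAState N M) : GDAState N M where
  matching s := (σ.applied next I s).filter (fun c => decide (σ.Accepted next I c s))
  rejected s := σ.rejected s ∪
    Finset.univ.filter (fun c => σ.applied next I s = some c ∧ ¬ σ.Accepted next I c s)

/-- The state after `k` rounds. -/
noncomputable def gdaState (next : NextRule N M F) (I : Instance N M F) (k : ℕ) : GDAState N M :=
  (GDAState.round next I)^[k] (GDAState.init N M)

/-- Every proposal goes to a college that has not yet rejected the student. -/
def NextRule.Valid (next : NextRule N M F) : Prop :=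
  ∀ s R u μ, R ≠ Finset.univ → ∃ c, c ∉ R ∧ next s R u μ = some c

theorem gdaState_succ (next : NextRule N M F) (I : Instance N M F) (k : ℕ) :
    gdaState next I (k + 1) = (gdaState next I k).round next I := by
  simp only [gdaState, Function.iterate_succ_apply']

theorem GDAState.round_of_accepted (next : NextRule N M F) (I : Instance N M F)
    (σ : GDAState N M) {s : N} {c : M} (h : σ.Accepted next I c s) :
    (σ.round next I).matching s = some c ∧ (σ.round next I).rejected s = σ.rejected s := by
  classical
  have ha := h.1
  refine ⟨by simp [GDAState.round, ha, h], ?_⟩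
  ext c'
  simp only [GDAState.round, Finset.mem_union, Finset.mem_filter, Finset.mem_univ, true_and, ha,
    Option.some.injEq, or_iff_left_iff_imp]
  rintro ⟨rfl, h'⟩
  exact absurd h h'

open Classical in
theorem GDAState.round_of_not_accepted (next : NextRule N M F) (I : Instance N M F)
    (σ : GDAState N M) {s : N} {c : M} (ha : σ.applied next I s = some c)
    (h : ¬ σ.Accepted next I c s) :
    (σ.round next I).matching s = none ∧
      (σ.round next I).rejected s = σ.rejected s ∪ {c} := by
  refine ⟨by simp [GDAState.round, ha, h], ?_⟩
  ext c'
  simp only [GDAState.round, Finset.mem_union, Finset.mem_filter, Finset.mem_univ, true_and, ha,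
    Option.some.injEq, Finset.mem_singleton]
  constructor
  · rintro (h1 | ⟨rfl, -⟩)
    · exact Or.inl h1
    · exact Or.inr rfl
  · rintro (h1 | rfl)
    · exact Or.inl h1
    · exact Or.inr ⟨rfl, h⟩

theorem GDAState.round_of_none (next : NextRule N M F) (I : Instance N M F)
    (σ : GDAState N M) {s : N} (ha : σ.applied next I s = none) :
    (σ.round next I).matching s = none ∧ (σ.round next I).rejected s = σ.rejected s := by
  classical
  refine ⟨by simp [GDAState.round, ha], ?_⟩
  ext c'
  simp [GDAState.round, ha]

open Classical in
/-- Colleges never exceed their capacities. -/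
theorem gdaState_capacity (next : NextRule N M F) (I : Instance N M F) (k : ℕ) (s : N) (c : M)
    (h : (gdaState next I k).matching s = some c) :
    (Finset.univ.filter (fun s' => (gdaState next I k).matching s' = some c ∧
      I.prefers c s' s)).card < I.capacity c := by
  cases k with
  | zero => simp [gdaState, GDAState.init] at h
  | succ k =>
    rw [gdaState_succ] at h ⊢
    simp only [GDAState.round, Option.filter_eq_some_iff, decide_eq_true_eq] at h ⊢
    refine lt_of_le_of_lt (Finset.card_le_card ?_) h.2.2
    intro s' hs'
    simp only [Finset.mem_filter, Finset.mem_univ, true_and] at hs' ⊢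
    exact ⟨hs'.1.1, hs'.2⟩

/-- After the end of the loop, further rounds change nothing. -/
theorem GDAState.round_eq_self (next : NextRule N M F) (I : Instance N M F) (k : ℕ)
    (h : ∀ s, ¬ (gdaState next I k).Active s) :
    gdaState next I (k + 1) = gdaState next I k := by
  classical
  have happ : ∀ s, (gdaState next I k).applied next I s = (gdaState next I k).matching s :=
    fun s => by simp [GDAState.applied, h s]
  have hacc : ∀ s c, (gdaState next I k).matching s = some c →
      (gdaState next I k).Accepted next I c s := by
    intro s c hs
    refine ⟨by rw [happ, hs], ?_⟩
    simp only [happ]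
    exact gdaState_capacity next I k s c hs
  have key : ∀ s, (gdaState next I (k + 1)).matching s = (gdaState next I k).matching s ∧
      (gdaState next I (k + 1)).rejected s = (gdaState next I k).rejected s := by
    intro s
    rw [gdaState_succ]
    rcases hs : (gdaState next I k).matching s with _ | c
    · exact GDAState.round_of_none next I _ (by rw [happ, hs])
    · exact GDAState.round_of_accepted next I _ (hacc s c hs)
  rcases h1 : gdaState next I (k + 1) with ⟨m1, r1⟩
  rcases h2 : gdaState next I k with ⟨m2, r2⟩
  rw [h1, h2] at key
  congr 1
  · exact funext fun s => (key s).1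
  · exact funext fun s => (key s).2

/-- No student is matched with, or applies to, a college that has rejected her before. -/
theorem gdaState_applied_not_rejected {next : NextRule N M F} (hv : next.Valid)
    (I : Instance N M F) (k : ℕ) :
    (∀ s c, (gdaState next I k).matching s = some c → c ∉ (gdaState next I k).rejected s) ∧
    ∀ s c, (gdaState next I k).applied next I s = some c →
      c ∉ (gdaState next I k).rejected s := by
  classical
  have step : ∀ σ : GDAState N M, (∀ s c, σ.matching s = some c → c ∉ σ.rejected s) →
      ∀ s c, σ.applied next I s = some c → c ∉ σ.rejected s := by
    intro σ hσ s c hc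
    by_cases hact : σ.Active s
    · obtain ⟨c', hc', he⟩ := hv s (σ.rejected s) (I.utility s) (I.dist s) hact.2
      simp only [GDAState.applied, hact, if_true, he, Option.some.injEq] at hc
      exact hc ▸ hc'
    · simp only [GDAState.applied, hact, if_false] at hc
      exact hσ s c hc
  suffices h : ∀ s c, (gdaState next I k).matching s = some c →
      c ∉ (gdaState next I k).rejected s from ⟨h, step _ h⟩
  induction k with
  | zero => intro s c h; simp [gdaState, GDAState.init] at h
  | succ k ih =>
    intro s c h
    rw [gdaState_succ] at h ⊢
    have h' := h
    simp only [GDAState.round, Option.filter_eq_some_iff, decide_eq_true_eq] at h'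
    rw [(GDAState.round_of_accepted next I _ h'.2).2]
    exact step _ ih s c h'.1

open Classical in
/-- With a valid rule, the loop ends after at most `|N| * |M|` rounds. -/
theorem gda_terminates {next : NextRule N M F} (hv : next.Valid) (I : Instance N M F) (s : N) :
    ¬ (gdaState next I (Fintype.card N * Fintype.card M)).Active s := by
  let p : ℕ → N → ℕ := fun k s => ((gdaState next I k).rejected s).card +
    if (gdaState next I k).matching s = none then 0 else 1
  have hstep : ∀ k s, p k s + (if (gdaState next I k).Active s then 1 else 0) ≤ p (k + 1) s := by
    intro k s
    simp only [p]
    rw [gdaState_succ]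
    rcases ha : (gdaState next I k).applied next I s with _ | c
    · have hna : ¬ (gdaState next I k).Active s := by
        intro hact
        obtain ⟨c', -, he⟩ := hv s _ (I.utility s) (I.dist s) hact.2
        simp [GDAState.applied, hact, he] at ha
      have hm : (gdaState next I k).matching s = none := by
        simpa [GDAState.applied, hna] using ha
      simp [GDAState.round_of_none next I _ ha, hna, hm]
    · have hlt : (if (gdaState next I k).matching s = none then 0 else 1) +
          (if (gdaState next I k).Active s then 1 else 0) ≤ 1 := by
        by_cases hm : (gdaState next I k).matching s = none
        · simp only [hm, if_true]; split_ifs <;> simp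
        · simp [GDAState.Active, hm]
      by_cases h : (gdaState next I k).Accepted next I c s
      · rw [(GDAState.round_of_accepted next I _ h).1, (GDAState.round_of_accepted next I _ h).2]
        simp only [reduceCtorEq, if_false]
        omega
      · rw [(GDAState.round_of_not_accepted next I _ ha h).1,
          (GDAState.round_of_not_accepted next I _ ha h).2, Finset.card_union_of_disjoint
          (by simpa using (gdaState_applied_not_rejected hv I k).2 s c ha)]
        simp only [Finset.card_singleton, if_true]
        omega
  have hsum : ∀ k, (∀ s, ¬ (gdaState next I k).Active s) ∨ k ≤ ∑ s, p k s := by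
    intro k
    induction k with
    | zero => exact Or.inr (Nat.zero_le _)
    | succ k ih =>
      by_cases hk : ∀ s, ¬ (gdaState next I k).Active s
      · left; rwa [GDAState.round_eq_self next I k hk]
      · right
        have h1 := ih.resolve_left hk
        push Not at hk
        obtain ⟨s, hs⟩ := hk
        have : ∑ s, p k s < ∑ s, p (k + 1) s :=
          Finset.sum_lt_sum (fun s _ => le_trans (Nat.le_add_right _ _) (hstep k s))
            ⟨s, Finset.mem_univ _, by have := hstep k s; simp only [hs, if_true] at this; omega⟩
        omega
  intro hact
  have hbig := (hsum _).resolve_left (fun h => h s hact)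
  have hle : ∀ s, p (Fintype.card N * Fintype.card M) s ≤ Fintype.card M := by
    intro s
    simp only [p]
    split_ifs with hm
    · simpa using Finset.card_le_univ _
    · obtain ⟨c, hc⟩ := Option.ne_none_iff_exists'.1 hm
      exact Finset.card_lt_univ_of_notMem ((gdaState_applied_not_rejected hv I _).1 s c hc)
  have hlt : p (Fintype.card N * Fintype.card M) s < Fintype.card M := by
    simp only [p, hact.1, if_true, add_zero]
    exact lt_of_le_of_ne (Finset.card_le_univ _) 
      (fun h => hact.2 ((Finset.card_eq_iff_eq_univ _).1 h))
  have : ∑ s, p (Fintype.card N * Fintype.card M) s < ∑ _s : N, Fintype.card M :=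
    Finset.sum_lt_sum (fun s _ => hle s) ⟨s, Finset.mem_univ _, hlt⟩
  simp at this
  omega

/-- Generalized student-proposing deferred acceptance. The loop runs while there is an active
student; `|N| * |M|` rounds always reach its end, see `gda_terminates`, and rounds after the end
change nothing, see `GDAState.round_eq_self`. -/
noncomputable def GDA (next : NextRule N M F) (I : Instance N M F) : Matching N M :=
  (gdaState next I (Fintype.card N * Fintype.card M)).matching

open Classical in
/-- The iterated comparison vector of college `c`: the probabilities that `c` is weakly preferred to
each other college outside `R`, in ascending order. -/
noncomputable def iteratedComparisonVector (u : Utilities M F) (μ : ProbabilityMeasure (Weights F))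
    (R : Finset M) (c : M) : List ℝ :=
  ((Finset.univ.filter (fun c' => c' ∉ R ∧ c' ≠ c)).val.map (probWeaklyPrefers u μ c)).sort (· ≤ ·)

/-- `next` follows the rule of the lexicographic order of iterated comparison vectors, with some
tie-breaking: it picks a college outside `R` whose iterated comparison vector is lexicographically
maximal among the colleges outside `R`. -/
def IsLOICV (next : NextRule N M F) : Prop :=
  ∀ s R u μ, R ≠ Finset.univ → ∃ c, c ∉ R ∧ next s R u μ = some c ∧
    ∀ c', c' ∉ R → ¬ List.Lex (· < ·) (iteratedComparisonVector u μ R c)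
      (iteratedComparisonVector u μ R c')

end DeferredAcceptance

theorem IsLOICV.valid {N M F : Type*} [Fintype M] [Fintype F] {next : NextRule N M F}
    (h : IsLOICV next) : next.Valid := by
  intro s R u μ hR
  obtain ⟨c, hc, he, -⟩ := h s R u μ hR
  exact ⟨c, hc, he⟩

end SchoolChoice

/-!
A proposal made by a student depends only on the set of colleges that have rejected her, so she
proposes along a list that her report determines in advance: GDA is ordinary deferred acceptance
for these lists. Record a matching by the number of rejections of each student. Deferred acceptance
computes the least stable vector of rejection numbers, and the same students are unmatched in every
stable matching; together these show that no misreport brings a student to a college that rejected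
her when she was truthful (truncate her list after these rejections, then reduce it to the single
college in question). So it is enough that she always proposes to a college that beats each
remaining one with probability at least `1 / 2`.

With two features the weighted utilities are affine in the weight of one feature. A college that is
best at a median weight is at least as good as any other one on one side of the median, hence with
probability at least `1 / 2`, and LOICV selects a college with this property whenever there is one.
-/

namespace SchoolChoice

open MeasureTheory

section FiniteSets

open Finset

theorem exists_mem_forall_mem_not_rel {α : Type*} (r : α → α → Prop) [IsStrictOrder α r]
    {B : Finset α} (hB : B.Nonempty) : ∃ x ∈ B, ∀ y ∈ B, ¬ r y x := by
  let := partialOrderOfSO r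
  obtain ⟨x, hx⟩ := B.exists_minimal hB
  exact ⟨x, hx.prop, fun y hy => hx.not_lt hy⟩

open Classical in
theorem le_card_filter_card_filter_lt {α : Type*} (r : α → α → Prop) [IsStrictOrder α r]
    {B : Finset α} {n : ℕ} (h : n ≤ #B) : n ≤ #{x ∈ B | #{y ∈ B | r y x} < n} := by
  set G := {x ∈ B | #{y ∈ B | r y x} < n}
  by_contra! hlt
  have hne : (B \ G).Nonempty := by
    rw [← card_pos, card_sdiff_of_subset (filter_subset _ _)]
    lia
  obtain ⟨x, hx, hmin⟩ := exists_mem_forall_mem_not_rel r hne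
  obtain ⟨hxB, hxG⟩ := mem_sdiff.1 hx
  have hpred : {y ∈ B | r y x} ⊆ G := fun y hy => by
    obtain ⟨hyB, hyx⟩ := mem_filter.1 hy
    by_contra hyG
    exact hmin y (mem_sdiff.2 ⟨hyB, hyG⟩) hyx
  exact hxG (mem_filter.2 ⟨hxB, (card_le_card hpred).trans_lt hlt⟩)

open Classical in
theorem card_filter_ne_none_le {α β : Type*} [Fintype α] {a b : α → Option β}
    (h : ∀ c, #{x | a x = some c} ≤ #{x | b x = some c}) :
    #{x | a x ≠ none} ≤ #{x | b x ≠ none} := by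
  have card_eq_sum (f : α → Option β) (hf : ∀ x, f x ∈ univ.image a ∪ univ.image b) :
      #{x | f x ≠ none} = ∑ o ∈ (univ.image a ∪ univ.image b).erase none, #{x | f x = o} := by
    rw [card_eq_sum_card_fiberwise (f := f) (t := (univ.image a ∪ univ.image b).erase none)
      fun x hx => mem_erase.2 ⟨(mem_filter.1 hx).2, hf x⟩]
    refine sum_congr rfl fun o ho => ?_
    rw [filter_filter]
    exact congrArg card (filter_congr fun x _ =>
      and_iff_right_of_imp fun hx => hx ▸ (mem_erase.1 ho).1)
  rw [card_eq_sum a (by simp), card_eq_sum b (by simp)]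
  refine sum_le_sum fun o ho => ?_
  obtain ⟨c, rfl⟩ := Option.ne_none_iff_exists'.1 (mem_erase.1 ho).1
  exact h c

end FiniteSets

section StableMatchings

open Finset Function

variable {N M : Type*}

/-- The assignment in which each student `s` has been rejected by the first `k s` colleges of her
list `p s` and applies to the next one, if there is one. -/
def held (p : N → List M) (k : N → ℕ) : N → Option M := fun s => (p s)[k s]?

theorem held_ne_none_of_le {p : N → List M} {k m : N → ℕ} {s : N} (hkm : k ≤ m)
    (hs : held p m s ≠ none) : held p k s ≠ none := by
  simp only [held, ne_eq, List.getElem?_eq_none_iff, not_le] at hs ⊢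
  exact (hkm s).trans_lt hs

variable [Fintype N]

open Classical in
/-- College `c` receives, under the assignment `a` of students to colleges, at least `q c`
applications that it prefers to that of `s`. Here `q` gives the capacities and `r c` the strict
preference of `c`; `s` need not apply to `c`. -/
def Overdemanded (q : M → ℕ) (r : M → N → N → Prop) (a : N → Option M) (c : M) (s : N) : Prop :=
  q c ≤ #{s' | a s' = some c ∧ r c s' s}

/-- The matching `held p k` is stable for the lists `p`, the capacities `q` and the preferences `r`
of the colleges. Stability is a property of the vector `k` of rejection numbers, so that stable
matchings are compared by the pointwise order of `N → ℕ`, where smaller is better for the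
students. -/
structure IsStable (q : M → ℕ) (r : M → N → N → Prop) (p : N → List M) (k : N → ℕ) : Prop where
  rejected : ∀ s, ∀ c ∈ (p s).take (k s), Overdemanded q r (held p k) c s
  accepted : ∀ s c, held p k s = some c → ¬ Overdemanded q r (held p k) c s

open Classical in
/-- One round of deferred acceptance, on the level of rejection numbers: each student whose current
application is overdemanded is rejected. -/
noncomputable def advance (q : M → ℕ) (r : M → N → N → Prop) (p : N → List M) (k : N → ℕ) :
    N → ℕ :=
  fun s => if ∃ c, held p k s = some c ∧ Overdemanded q r (held p k) c s then k s + 1 else k s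

variable {q : M → ℕ} {r : M → N → N → Prop} {p p' : N → List M} {k m : N → ℕ} {s : N} {c : M}

theorem Overdemanded.mono {a b : N → Option M} {t : N} (h : Overdemanded q r a c s)
    (hab : ∀ s', a s' = some c → r c s' s → b s' = some c ∧ r c s' t) :
    Overdemanded q r b c t := by
  classical
  refine le_trans h (card_le_card fun x hx => ?_)
  simp only [mem_filter, mem_univ, true_and] at hx ⊢
  exact hab x hx.1 hx.2

theorem Overdemanded.trans_rel [IsTrans N (r c)] {a : N → Option M} {t : N}
    (h : Overdemanded q r a c s) (hst : r c s t) : Overdemanded q r a c t :=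
  h.mono fun _ hx hxs => ⟨hx, _root_.trans hxs hst⟩

theorem advance_of_overdemanded (hc : held p k s = some c)
    (h : Overdemanded q r (held p k) c s) : advance q r p k s = k s + 1 :=
  if_pos ⟨c, hc, h⟩

theorem advance_of_not_overdemanded (hc : held p k s = some c)
    (h : ¬ Overdemanded q r (held p k) c s) : advance q r p k s = k s := by
  refine if_neg ?_
  rintro ⟨d, hd, hod⟩
  obtain rfl : c = d := Option.some.inj (hc.symm.trans hd)
  exact h hod

theorem advance_of_held_eq_none (hs : held p k s = none) : advance q r p k s = k s := by
  simp [advance, hs]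

theorem le_advance : k ≤ advance q r p k := fun s => by
  rw [advance]
  split_ifs <;> lia

theorem advance_le_length (hk : ∀ s, k s ≤ (p s).length) (s : N) :
    advance q r p k s ≤ (p s).length := by
  rcases hs : held p k s with _ | c
  · rw [advance_of_held_eq_none hs]
    exact hk s
  · have hlt : k s < (p s).length := (List.getElem?_eq_some_iff.1 hs).1
    rw [advance]
    split_ifs <;> lia

/-- The `q c` applicants that `c` prefers most are not rejected. -/
theorem Overdemanded.held_advance [IsStrictOrder N (r c)]
    (h : Overdemanded q r (held p k) c s) :
    Overdemanded q r (held p (advance q r p k)) c s := by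
  classical
  refine (le_card_filter_card_filter_lt (r c) h).trans (card_le_card fun x hx => ?_)
  simp only [mem_filter, mem_univ, true_and] at hx ⊢
  obtain ⟨⟨hxc, hxs⟩, hlt⟩ := hx
  have hx_accepted : ¬ Overdemanded q r (held p k) c x := by
    refine not_le.2 ((card_le_card fun y hy => ?_).trans_lt hlt)
    simp only [mem_filter, mem_univ, true_and] at hy ⊢
    exact ⟨⟨hy.1, _root_.trans hy.2 hxs⟩, hy.2⟩
  refine ⟨?_, hxs⟩
  rw [held, advance_of_not_overdemanded hxc hx_accepted]
  exact hxc

theorem overdemanded_of_mem_take_advance [IsStrictOrder N (r c)]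
    (h : ∀ s, ∀ c ∈ (p s).take (k s), Overdemanded q r (held p k) c s)
    (hc : c ∈ (p s).take (advance q r p k s)) :
    Overdemanded q r (held p (advance q r p k)) c s := by
  refine Overdemanded.held_advance ?_
  by_cases hrej : ∃ d, held p k s = some d ∧ Overdemanded q r (held p k) d s
  · obtain ⟨d, hd, hod⟩ := hrej
    have hget : (p s)[k s]? = some d := hd
    rw [advance_of_overdemanded hd hod, List.take_add_one, hget, Option.toList_some,
      List.mem_append, List.mem_singleton] at hc
    rcases hc with hc | rfl
    · exact h s c hc
    · exact hod
  · rw [advance, if_neg hrej] at hc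
    exact h s c hc

theorem overdemanded_of_mem_take_iterate_advance [∀ c, IsStrictOrder N (r c)] (n : ℕ) (s : N) :
    ∀ c ∈ (p s).take ((advance q r p)^[n] 0 s),
      Overdemanded q r (held p ((advance q r p)^[n] 0)) c s := by
  induction n generalizing s with
  | zero => simp
  | succ n ih =>
    simp only [iterate_succ_apply']
    exact fun c hc => overdemanded_of_mem_take_advance ih hc

/-- An applicant preferred to `s` that has left `c` between `k` and `m` was rejected by `c`, and
then so is `s`. -/
theorem IsStable.not_overdemanded_of_le [IsTrans N (r c)] (hm : IsStable q r p m)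
    (hkm : k ≤ m) (hc : held p m s = some c) : ¬ Overdemanded q r (held p k) c s := by
  intro hk
  refine hm.accepted s c hc (hk.mono fun x hx hxs => ⟨?_, hxs⟩)
  rcases (hkm x).lt_or_eq with hlt | heq
  · have hmem : c ∈ (p x).take (m x) :=
      List.mem_of_getElem? ((List.getElem?_take_of_lt hlt).trans hx)
    exact absurd ((hm.rejected x c hmem).trans_rel hxs) (hm.accepted s c hc)
  · rw [held, ← heq]
    exact hx

theorem advance_le_of_isStable [∀ c, IsTrans N (r c)] (hm : IsStable q r p m) (hkm : k ≤ m) :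
    advance q r p k ≤ m := by
  intro s
  rw [advance]
  split_ifs with hrej
  · obtain ⟨c, hc, ho⟩ := hrej
    refine (hkm s).lt_of_ne fun heq => hm.not_overdemanded_of_le hkm (s := s) ?_ ho
    rwa [held, ← heq]
  · exact hkm s

theorem iterate_advance_le_of_isStable [∀ c, IsTrans N (r c)] (hm : IsStable q r p m) (n : ℕ) :
    (advance q r p)^[n] 0 ≤ m := by
  induction n with
  | zero => exact fun s => Nat.zero_le _
  | succ n ih =>
    rw [iterate_succ_apply']
    exact advance_le_of_isStable hm ih

theorem isLeast_isStable_iterate_advance [∀ c, IsStrictOrder N (r c)] {n : ℕ}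
    (h : ∀ s c, held p ((advance q r p)^[n] 0) s = some c →
      ¬ Overdemanded q r (held p ((advance q r p)^[n] 0)) c s) :
    IsLeast {k | IsStable q r p k} ((advance q r p)^[n] 0) :=
  ⟨⟨overdemanded_of_mem_take_iterate_advance n, h⟩,
    fun _ hm => iterate_advance_le_of_isStable hm n⟩

theorem exists_isFixedPt_iterate_advance (q : M → ℕ) (r : M → N → N → Prop) (p : N → List M) :
    ∃ n, IsFixedPt (advance q r p) ((advance q r p)^[n] 0) := by
  classical
  have hbdd : ∀ n, (advance q r p)^[n] 0 ≤ fun s => (p s).length := by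
    intro n
    induction n with
    | zero => exact fun s => Nat.zero_le _
    | succ n ih =>
      rw [iterate_succ_apply']
      exact advance_le_length ih
  have hfin : (Set.range fun n => (advance q r p)^[n] 0).Finite :=
    (Set.finite_Iic fun s => (p s).length).subset (Set.range_subset_iff.2 hbdd)
  obtain ⟨_, ⟨n, rfl⟩, hmax⟩ := hfin.exists_maximal (Set.range_nonempty _)
  exact ⟨n, le_antisymm (hmax ⟨n + 1, iterate_succ_apply' _ _ _⟩ le_advance) le_advance⟩

theorem exists_isLeast_isStable [∀ c, IsStrictOrder N (r c)] (q : M → ℕ) (p : N → List M) :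
    ∃ k, IsLeast {k | IsStable q r p k} k := by
  obtain ⟨n, hn⟩ := exists_isFixedPt_iterate_advance q r p
  refine ⟨_, isLeast_isStable_iterate_advance (n := n) fun s c hc ho => ?_⟩
  have hfixed := congrFun hn s
  rw [advance_of_overdemanded hc ho] at hfixed
  lia

open Classical in
theorem card_filter_eq_some_le [IsStrictTotalOrder N (r c)] {a : N → Option M}
    (h : ∀ s, a s = some c → ¬ Overdemanded q r a c s) : #{s | a s = some c} ≤ q c := by
  by_contra! hlt
  obtain ⟨worst, hworst, hmax⟩ := exists_mem_forall_mem_not_rel (swap (r c))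
    (card_pos.1 (hlt.trans_le' (Nat.zero_le _)))
  have hpref : ({s | a s = some c} : Finset N).erase worst ⊆
      ({s | a s = some c ∧ r c s worst} : Finset N) := by
    intro s hs
    obtain ⟨hne, hs⟩ := mem_erase.1 hs
    rcases trichotomous_of (r c) s worst with hrel | heq | hrel
    · exact mem_filter.2 ⟨mem_univ _, (mem_filter.1 hs).2, hrel⟩
    · exact absurd heq hne
    · exact absurd hrel (hmax s hs)
  refine h worst (mem_filter.1 hworst).2 ((Nat.le_sub_one_of_lt hlt).trans ?_)
  rw [← card_erase_of_mem hworst]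
  exact card_le_card hpref

open Classical in
/-- Either no student leaves `c`, or `c` rejects somebody and is then filled to capacity. -/
theorem IsStable.card_filter_held_le_of_le [IsStrictTotalOrder N (r c)]
    (hk : IsStable q r p k) (hm : IsStable q r p m) (hkm : k ≤ m) :
    #{s | held p k s = some c} ≤ #{s | held p m s = some c} := by
  by_cases hstay : ∀ s, held p k s = some c → held p m s = some c
  · exact card_le_card (monotone_filter_right _ fun s _ => hstay s)
  · push Not at hstay
    obtain ⟨s, hs, hsm⟩ := hstay
    have hlt : k s < m s := (hkm s).lt_of_ne fun heq => hsm (by rwa [held, ← heq])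
    have hmem : c ∈ (p s).take (m s) :=
      List.mem_of_getElem? ((List.getElem?_take_of_lt hlt).trans hs)
    calc #{s | held p k s = some c} ≤ q c := card_filter_eq_some_le fun s => hk.accepted s c
      _ ≤ #{s' | held p m s' = some c ∧ r c s' s} := hm.rejected s c hmem
      _ ≤ #{s | held p m s = some c} := card_le_card (monotone_filter_right _ fun _ _ h => h.1)

theorem IsStable.held_eq_none_iff [∀ c, IsStrictTotalOrder N (r c)]
    (hk : IsStable q r p k) (hm : IsStable q r p m) : held p k s = none ↔ held p m s = none := by
  classical
  obtain ⟨l, hl, hle⟩ := exists_isLeast_isStable (r := r) q p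
  have matched_eq {j : N → ℕ} (hj : IsStable q r p j) :
      ({s | held p j s ≠ none} : Finset N) = ({s | held p l s ≠ none} : Finset N) :=
    eq_of_subset_of_card_le
      (monotone_filter_right _ fun _ _ => held_ne_none_of_le (hle hj))
      (card_filter_ne_none_le fun _ => hl.card_filter_held_le_of_le hj (hle hj))
  have hiff := Finset.ext_iff.1 ((matched_eq hk).trans (matched_eq hm).symm) s
  simpa only [mem_filter, mem_univ, true_and, not_iff_not] using hiff

theorem IsStable.of_held_eq (hm : IsStable q r p m) (hheld : held p' k = held p m)
    (hrej : ∀ s, (p' s).take (k s) ⊆ (p s).take (m s)) : IsStable q r p' k where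
  rejected s c hc := hheld ▸ hm.rejected s c (hrej s hc)
  accepted := hheld ▸ hm.accepted

open Classical in
theorem exists_isStable_update_take [∀ c, IsStrictOrder N (r c)]
    (hk : IsLeast {k | IsStable q r p k} k) (s : N) :
    ∃ m, IsStable q r (update p s ((p s).take (k s))) m ∧ k s ≤ m s := by
  obtain ⟨m, hm, -⟩ := exists_isLeast_isStable (r := r) q (update p s ((p s).take (k s)))
  refine ⟨m, hm, ?_⟩
  by_contra! hlt
  refine hlt.not_ge (hk.2 (hm.of_held_eq (funext fun t => ?_) fun t => ?_) s)
  all_goals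
    obtain rfl | hts := eq_or_ne t s
  · simp [held, hlt]
  · simp [held, hts]
  · simp [List.take_take, hlt.le]
  · simp [hts]

open Classical in
theorem exists_isStable_update_singleton_held_eq_none [∀ c, IsStrictOrder N (r c)]
    (hk : IsLeast {k | IsStable q r p k} k) (hc : c ∈ (p s).take (k s)) :
    ∃ m, IsStable q r (update p s [c]) m ∧ held (update p s [c]) m s = none := by
  obtain ⟨m, hm, hkm⟩ := exists_isStable_update_take hk s
  refine ⟨update m s 1, hm.of_held_eq (funext fun t => ?_) fun t => ?_, by simp [held]⟩
  all_goals
    obtain rfl | hts := eq_or_ne t s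
  · simp [held, hkm]
  · simp [held, hts]
  · simpa [List.take_take, hkm] using hc
  · simp [hts]

open Classical in
theorem IsStable.update_singleton (hm : IsStable q r p m) (hs : held p m s = some c) :
    IsStable q r (update p s [c]) (update m s 0) := by
  refine hm.of_held_eq (funext fun t => ?_) fun t => ?_
  all_goals
    obtain rfl | hts := eq_or_ne t s
  · simp [held, ← hs]
  · simp [held, hts]
  · simp
  · simp [hts]

theorem held_ne_some_of_mem_take_of_isLeast [∀ c, IsStrictTotalOrder N (r c)]
    (hk : IsLeast {k | IsStable q r p k} k) (hm : IsStable q r p' m)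
    (hpp' : ∀ t ≠ s, p' t = p t) (hc : c ∈ (p s).take (k s)) : held p' m s ≠ some c := by
  classical
  intro hs
  have hupdate : update p' s [c] = update p s [c] := by
    funext t
    obtain rfl | hts := eq_or_ne t s
    · simp
    · simp [hts, hpp' t hts]
  obtain ⟨l, hl, hnone⟩ := exists_isStable_update_singleton_held_eq_none hk hc
  have hmatched := hm.update_singleton hs
  rw [hupdate] at hmatched
  simpa [held] using (hl.held_eq_none_iff hmatched).1 hnone

end StableMatchings

section ProposalLists

variable {N M F : Type*} [Fintype M] [Fintype F]

open Classical in
/-- The colleges to which student `s` proposes from the moment on when exactly the colleges in `R`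
have rejected her, in this order, provided that she is rejected by all but the last of them. The
list ends where `next` gives no college outside the current set of rejections. -/
noncomputable def proposalList (next : NextRule N M F) (s : N) (u : Utilities M F)
    (μ : ProbabilityMeasure (Weights F)) (R : Finset M) : List M :=
  if h : ∃ c, c ∉ R ∧ next s R u μ = some c then
    h.choose :: proposalList next s u μ (insert h.choose R)
  else []
termination_by Rᶜ.card
decreasing_by
  exact Finset.card_lt_card (Finset.compl_ssubset_compl.2 (Finset.ssubset_insert h.choose_spec.1))

/-- The proposal lists of all students in the instance `I`. -/
noncomputable def proposals (next : NextRule N M F) (I : Instance N M F) (s : N) : List M :=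
  proposalList next s (I.utility s) (I.dist s) ∅

variable {next : NextRule N M F} {s : N} {u : Utilities M F} {μ : ProbabilityMeasure (Weights F)}
  {R : Finset M}

theorem proposalList_univ : proposalList next s u μ Finset.univ = [] := by
  rw [proposalList]
  simp

open Classical in
theorem proposalList_of_next_eq_some {c : M} (hcR : c ∉ R) (hc : next s R u μ = some c) :
    proposalList next s u μ R = c :: proposalList next s u μ (insert c R) := by
  have h : ∃ c, c ∉ R ∧ next s R u μ = some c := ⟨c, hcR, hc⟩
  have hchoose : h.choose = c := Option.some.inj (h.choose_spec.2.symm.trans hc)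
  rw [proposalList, dif_pos h, hchoose]

open Classical in
theorem getElem?_proposalList (hv : next.Valid) (R : Finset M) (i : ℕ) :
    (proposalList next s u μ R)[i]? =
      if R ∪ ((proposalList next s u μ R).take i).toFinset = Finset.univ then none
      else next s (R ∪ ((proposalList next s u μ R).take i).toFinset) u μ := by
  induction i generalizing R with
  | zero =>
    by_cases hR : R = Finset.univ
    · simp [hR, proposalList_univ]
    · obtain ⟨c, hcR, hc⟩ := hv s R u μ hR
      simp [proposalList_of_next_eq_some hcR hc, hR, hc]
  | succ i ih =>
    by_cases hR : R = Finset.univ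
    · simp [hR, proposalList_univ]
    · obtain ⟨c, hcR, hc⟩ := hv s R u μ hR
      rw [proposalList_of_next_eq_some hcR hc, List.getElem?_cons_succ, ih, List.take_succ_cons,
        List.toFinset_cons, Finset.insert_union, Finset.union_insert]

end ProposalLists

section DeferredAcceptanceOnLists

open Function

variable {N M F : Type*} [Fintype M] [Fintype F] {next : NextRule N M F}
  {I : Instance N M F} {σ : GDAState N M} {k : N → ℕ} {s : N}

open Classical in
theorem held_proposals (hv : next.Valid) (I : Instance N M F) (k : N → ℕ) (s : N) :
    held (proposals next I) k s =
      if ((proposals next I s).take (k s)).toFinset = Finset.univ then none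
      else next s ((proposals next I s).take (k s)).toFinset (I.utility s) (I.dist s) := by
  have h := getElem?_proposalList (s := s) (u := I.utility s) (μ := I.dist s) hv ∅ (k s)
  rwa [Finset.empty_union] at h

theorem proposals_misreport_of_ne {t : N} (hts : t ≠ s) (u' : Utilities M F)
    (μ' : ProbabilityMeasure (Weights F)) :
    proposals next (I.misreport s u' μ') t = proposals next I t := by
  classical
  simp only [proposals, Instance.misreport, update_of_ne hts]

open Classical in
/-- The state `σ` arises from the lists `p` and the rejection numbers `k`: student `s` has been
rejected by the first `k s` colleges of her list, and the college she is matched with, if any, is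
the next one. -/
def GDAState.Tracks (σ : GDAState N M) (p : N → List M) (k : N → ℕ) : Prop :=
  ∀ s, σ.rejected s = ((p s).take (k s)).toFinset ∧
    (σ.matching s = none ∨ σ.matching s = held p k s)

theorem GDAState.Tracks.applied_eq_held (hv : next.Valid) (hσ : σ.Tracks (proposals next I) k) :
    σ.applied next I = held (proposals next I) k := by
  funext s
  obtain ⟨hrej, hmatch⟩ := hσ s
  have hheld := held_proposals hv I k s
  rw [← hrej] at hheld
  by_cases hact : σ.Active s
  · rw [GDAState.applied, if_pos hact, hheld, if_neg hact.2]
  · rw [GDAState.applied, if_neg hact]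
    rcases hmatch with hnone | heq
    · have huniv : σ.rejected s = Finset.univ := by
        by_contra hne
        exact hact ⟨hnone, hne⟩
      rw [hnone, hheld, if_pos huniv]
    · exact heq

variable [Fintype N]

theorem GDAState.accepted_iff {c : M} : σ.Accepted next I c s ↔ σ.applied next I s = some c ∧
    ¬ Overdemanded I.capacity I.prefers (σ.applied next I) c s := by
  rw [GDAState.Accepted, Overdemanded, not_le]

theorem GDAState.Tracks.round (hv : next.Valid) (hσ : σ.Tracks (proposals next I) k) :
    (σ.round next I).Tracks (proposals next I)
      (advance I.capacity I.prefers (proposals next I) k) := by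
  classical
  intro s
  obtain ⟨hrej, -⟩ := hσ s
  have happ := hσ.applied_eq_held hv
  rcases hs : held (proposals next I) k s with _ | c
  · obtain ⟨hmatch', hrej'⟩ := round_of_none next I σ ((congrFun happ s).trans hs)
    rw [advance_of_held_eq_none hs, hrej']
    exact ⟨hrej, Or.inl hmatch'⟩
  have happc : σ.applied next I s = some c := (congrFun happ s).trans hs
  by_cases ho : Overdemanded I.capacity I.prefers (held (proposals next I) k) c s
  · obtain ⟨hmatch', hrej'⟩ := round_of_not_accepted next I σ happc
      fun hacc => (accepted_iff.1 hacc).2 (happ ▸ ho)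
    have hget : (proposals next I s)[k s]? = some c := hs
    refine ⟨?_, Or.inl hmatch'⟩
    rw [hrej', hrej, advance_of_overdemanded hs ho, List.take_add_one, hget, Option.toList_some,
      List.toFinset_append]
    simp
  · obtain ⟨hmatch', hrej'⟩ :=
      round_of_accepted next I σ (accepted_iff.2 ⟨happc, happ ▸ ho⟩)
    refine ⟨?_, Or.inr ?_⟩
    · rw [hrej', hrej, advance_of_not_overdemanded hs ho]
    · rw [hmatch', held, advance_of_not_overdemanded hs ho]
      exact hs.symm

theorem tracks_gdaState (hv : next.Valid) (I : Instance N M F) (n : ℕ) :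
    (gdaState next I n).Tracks (proposals next I)
      ((advance I.capacity I.prefers (proposals next I))^[n] 0) := by
  induction n with
  | zero => exact fun s => ⟨rfl, Or.inl rfl⟩
  | succ n ih =>
    rw [gdaState_succ, iterate_succ_apply']
    exact ih.round hv

/-- The colleges that have rejected student `s` when generalized deferred acceptance ends, in the
state from which `GDA` reads off its matching. -/
noncomputable def finalRejected (next : NextRule N M F) (I : Instance N M F) (s : N) : Finset M :=
  (gdaState next I (Fintype.card N * Fintype.card M)).rejected s

open Classical in
theorem exists_isLeast_isStable_GDA_eq_held (hv : next.Valid) (I : Instance N M F) :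
    ∃ k, IsLeast {k | IsStable I.capacity I.prefers (proposals next I) k} k ∧
      GDA next I = held (proposals next I) k ∧
      ∀ s, finalRejected next I s = ((proposals next I s).take (k s)).toFinset := by
  have := I.prefers_strict
  have htracks := tracks_gdaState hv I (Fintype.card N * Fintype.card M)
  have heq := htracks.applied_eq_held hv
  have happ : (gdaState next I (Fintype.card N * Fintype.card M)).applied next I = GDA next I :=
    funext fun s => if_neg (gda_terminates hv I s)
  rw [happ] at heq
  refine ⟨_, isLeast_isStable_iterate_advance fun s c hs => ?_, heq, fun s => (htracks s).1⟩
  rw [← heq] at hs ⊢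
  exact not_le.2 (gdaState_capacity next I _ s c hs)

theorem GDA_eq_next_finalRejected (hv : next.Valid) (h : finalRejected next I s ≠ Finset.univ) :
    GDA next I s = next s (finalRejected next I s) (I.utility s) (I.dist s) := by
  classical
  obtain ⟨k, -, heq, hrej⟩ := exists_isLeast_isStable_GDA_eq_held hv I
  rw [hrej] at h ⊢
  rw [heq, held_proposals hv, if_neg h]

theorem notMem_finalRejected_of_GDA_misreport_eq_some (hv : next.Valid) {u' : Utilities M F}
    {μ' : ProbabilityMeasure (Weights F)} {c : M}
    (hc : GDA next (I.misreport s u' μ') s = some c) : c ∉ finalRejected next I s := by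
  classical
  have := I.prefers_strict
  obtain ⟨k, hk, -, hrej⟩ := exists_isLeast_isStable_GDA_eq_held hv I
  obtain ⟨m, hm, heq, -⟩ := exists_isLeast_isStable_GDA_eq_held hv (I.misreport s u' μ')
  rw [hrej, List.mem_toFinset]
  exact fun hmem => held_ne_some_of_mem_take_of_isLeast hk hm.1
    (fun t hts => proposals_misreport_of_ne hts u' μ') hmem (heq ▸ hc)

end DeferredAcceptanceOnLists

section CondorcetRules

variable {N M F : Type*} [Fintype F] {u : Utilities M F} {μ : ProbabilityMeasure (Weights F)}

/-- College `c` is weakly preferred to each college in `S`, of which it is one, with probability at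
least `1 / 2`. -/
def IsWeakCondorcetWinner (u : Utilities M F) (μ : ProbabilityMeasure (Weights F)) (S : Set M)
    (c : M) : Prop :=
  c ∈ S ∧ ∀ c' ∈ S, 1 / 2 ≤ probWeaklyPrefers u μ c c'

/-- The rule `next` always proposes to a weak Condorcet winner among the colleges that have not yet
rejected the student. -/
def NextRule.IsCondorcet [Fintype M] (next : NextRule N M F) : Prop :=
  ∀ s R u μ, R ≠ Finset.univ →
    ∃ c, next s R u μ = some c ∧ IsWeakCondorcetWinner u μ (↑R : Set M)ᶜ c

theorem NextRule.IsCondorcet.valid [Fintype M] {next : NextRule N M F} (h : next.IsCondorcet) :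
    next.Valid := fun s R u μ hR =>
  let ⟨c, hc, hwin⟩ := h s R u μ hR
  ⟨c, hwin.1, hc⟩

theorem measurable_weightedUtility (u : Utilities M F) (c : M) :
    Measurable fun w : Weights F => weightedUtility u w c :=
  Finset.measurable_sum _ fun f _ =>
    ((measurable_pi_apply f).comp measurable_subtype_coe).mul_const _

theorem measureReal_strictlyBetter_some_some (c c' : M) :
    (μ : Measure (Weights F)).real {w | StrictlyBetter u w (some c') (some c)} =
      1 - probWeaklyPrefers u μ c c' := by
  rw [probWeaklyPrefers, ← probReal_compl_eq_one_sub
    (measurableSet_le (measurable_weightedUtility u c') (measurable_weightedUtility u c))]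
  congr 1
  ext w
  exact (not_le (α := ℝ)).symm

theorem probWeaklyPrefers_self (c : M) : probWeaklyPrefers u μ c c = 1 := by
  simp [probWeaklyPrefers]

theorem isICR_GDA_of_isCondorcet [Fintype N] [Fintype M] {next : NextRule N M F}
    (h : next.IsCondorcet) : IsICR (GDA next) := by
  intro I s u' μ'
  rw [not_lt]
  rcases hmis : GDA next (I.misreport s u' μ') s with _ | c'
  · simp [StrictlyBetter]
  · have hc' := notMem_finalRejected_of_GDA_misreport_eq_some h.valid hmis
    have hne : finalRejected next I s ≠ Finset.univ :=
      fun huniv => hc' (huniv ▸ Finset.mem_univ c')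
    obtain ⟨c, hc, -, hwin⟩ := h s _ (I.utility s) (I.dist s) hne
    rw [GDA_eq_next_finalRejected h.valid hne, hc, measureReal_strictlyBetter_some_some]
    linarith [hwin c' hc']

end CondorcetRules

section TwoFeatures

theorem exists_median (ν : Measure ℝ) [IsProbabilityMeasure ν] :
    ∃ m : ℝ, 1 / 2 ≤ ν.real (Set.Iic m) ∧ 1 / 2 ≤ ν.real (Set.Ici m) := by
  set G := ProbabilityTheory.cdf ν with hG
  let S := {t : ℝ | 1 / 2 ≤ G t}
  have hne : S.Nonempty := ((ProbabilityTheory.tendsto_cdf_atTop ν).eventually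
    (eventually_ge_nhds (by norm_num : (1 / 2 : ℝ) < 1))).exists
  have hbdd : BddBelow S := by
    obtain ⟨l, hl⟩ := ((ProbabilityTheory.tendsto_cdf_atBot ν).eventually
      (eventually_lt_nhds (by norm_num : (0 : ℝ) < 1 / 2))).exists
    exact ⟨l, fun t ht => (G.mono.reflect_lt (hl.trans_le ht)).le⟩
  have hright : 1 / 2 ≤ G (sInf S) := by
    refine ge_of_tendsto (((G.right_continuous (sInf S)).mono Set.Ioi_subset_Ici_self).tendsto)
      (eventually_mem_nhdsWithin.mono fun t ht => ?_)
    obtain ⟨t', ht', hlt⟩ := exists_lt_of_csInf_lt hne ht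
    exact le_trans ht' (G.mono hlt.le)
  have hleft : Function.leftLim G (sInf S) ≤ 1 / 2 :=
    le_of_tendsto (G.mono.tendsto_leftLim (sInf S)) (eventually_mem_nhdsWithin.mono fun t ht =>
      (not_le.1 fun h => (csInf_le hbdd h).not_gt ht).le)
  refine ⟨sInf S, by rwa [← ProbabilityTheory.cdf_eq_real], ?_⟩
  have hIci := G.measure_Ici (ProbabilityTheory.tendsto_cdf_atTop ν) (sInf S)
  rw [hG, ProbabilityTheory.measure_cdf, ← hG] at hIci
  rw [measureReal_def, hIci, ENNReal.toReal_ofReal] <;> linarith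

theorem half_le_measureReal_affine_nonneg {ν : Measure ℝ} [IsFiniteMeasure ν] {m a b : ℝ}
    (hIic : 1 / 2 ≤ ν.real (Set.Iic m)) (hIci : 1 / 2 ≤ ν.real (Set.Ici m))
    (hm : 0 ≤ a * m + b) : 1 / 2 ≤ ν.real {t | 0 ≤ a * t + b} := by
  rcases le_total 0 a with ha | ha
  · refine hIci.trans (measureReal_mono fun t ht => hm.trans ?_)
    have := mul_le_mul_of_nonneg_left (Set.mem_Ici.1 ht) ha
    linarith
  · refine hIic.trans (measureReal_mono fun t ht => hm.trans ?_)
    have := mul_le_mul_of_nonpos_left (Set.mem_Iic.1 ht) ha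
    linarith

variable {M F : Type*} [Fintype F]

theorem weightedUtility_eq_of_univ_eq_pair [DecidableEq F] {f g : F} (hfg : f ≠ g)
    (huniv : (Finset.univ : Finset F) = {f, g}) (u : Utilities M F) (w : Weights F) (c : M) :
    weightedUtility u w c = ((u f c : ℝ) - u g c) * (w : F → ℝ) f + u g c := by
  have hsum : (w : F → ℝ) f + (w : F → ℝ) g = 1 := by
    have := w.2.2
    rwa [huniv, Finset.sum_pair hfg] at this
  rw [weightedUtility, huniv, Finset.sum_pair hfg, eq_sub_of_add_eq' hsum]
  ring

theorem exists_isWeakCondorcetWinner (hF : Fintype.card F = 2) (u : Utilities M F)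
    (μ : ProbabilityMeasure (Weights F)) {S : Set M} (hfin : S.Finite) (hS : S.Nonempty) :
    ∃ c, IsWeakCondorcetWinner u μ S c := by
  classical
  obtain ⟨f, g, hfg, huniv⟩ := Finset.card_eq_two.1 ((Finset.card_univ (α := F)).trans hF)
  have hmeas : Measurable fun w : Weights F => (w : F → ℝ) f :=
    (measurable_pi_apply f).comp measurable_subtype_coe
  let ν : Measure ℝ := (μ : Measure (Weights F)).map fun w : Weights F => (w : F → ℝ) f
  have : IsProbabilityMeasure ν := Measure.isProbabilityMeasure_map hmeas.aemeasurable
  obtain ⟨m, hIic, hIci⟩ := exists_median ν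
  obtain ⟨c, hc, hmax⟩ :=
    Set.exists_max_image S (fun c => ((u f c : ℝ) - u g c) * m + u g c) hfin hS
  refine ⟨c, hc, fun c' hc' => ?_⟩
  have hhalf := half_le_measureReal_affine_nonneg hIic hIci
    (a := ((u f c : ℝ) - u g c) - (u f c' - u g c')) (b := (u g c : ℝ) - u g c')
    (by linarith [hmax c' hc'])
  rw [map_measureReal_apply hmeas (measurableSet_le measurable_const (by fun_prop))] at hhalf
  refine hhalf.trans (measureReal_mono fun w hw => ?_)
  simp only [Set.mem_preimage, Set.mem_ofPred_eq,
    weightedUtility_eq_of_univ_eq_pair hfg huniv] at hw ⊢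
  linarith

end TwoFeatures

section LOICV

theorem lex_lt_of_mem_of_lt {α : Type*} [Preorder α] {l l' : List α} {x t : α}
    (hl : l.Pairwise (· ≤ ·)) (hx : x ∈ l) (hxt : x < t) (hne : l' ≠ []) (ht : ∀ y ∈ l', t ≤ y) :
    List.Lex (· < ·) l l' := by
  rcases l with _ | ⟨a, l⟩
  · simp at hx
  rcases l' with _ | ⟨b, l'⟩
  · exact absurd rfl hne
  have hax : a ≤ x := by
    rcases List.mem_cons.1 hx with rfl | hx
    · exact le_rfl
    · exact List.rel_of_pairwise_cons hl hx
  exact List.Lex.rel ((hax.trans_lt hxt).trans_le (ht b List.mem_cons_self))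

variable {N M F : Type*} [Fintype M] [Fintype F]

theorem mem_iteratedComparisonVector {u : Utilities M F} {μ : ProbabilityMeasure (Weights F)}
    {R : Finset M} {c : M} {x : ℝ} : x ∈ iteratedComparisonVector u μ R c ↔
      ∃ c', (c' ∉ R ∧ c' ≠ c) ∧ probWeaklyPrefers u μ c c' = x := by
  simp [iteratedComparisonVector]

/-- The least entry of the vector of a weak Condorcet winner is at least `1 / 2`, so the least entry
of a lexicographically maximal vector is as well. -/
theorem IsLOICV.isCondorcet {next : NextRule N M F} (h : IsLOICV next)
    (hF : Fintype.card F = 2) : next.IsCondorcet := by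
  intro s R u μ hR
  obtain ⟨c, hcR, hc, hmax⟩ := h s R u μ hR
  refine ⟨c, hc, hcR, fun c' hc' => ?_⟩
  by_contra! hlt
  have hne : c' ≠ c := by
    rintro rfl
    norm_num [probWeaklyPrefers_self] at hlt
  obtain ⟨d, hdR, hwin⟩ := exists_isWeakCondorcetWinner hF u μ (Set.toFinite (↑R : Set M)ᶜ) ⟨c, hcR⟩
  have hcd : c ≠ d := by
    rintro rfl
    exact (hwin c' hc').not_gt hlt
  refine hmax d hdR (lex_lt_of_mem_of_lt (Multiset.pairwise_sort _ _)
    (mem_iteratedComparisonVector.2 ⟨c', ⟨hc', hne⟩, rfl⟩) hlt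
    (List.ne_nil_of_mem (mem_iteratedComparisonVector.2 ⟨c, ⟨hcR, hcd⟩, rfl⟩)) fun y hy => ?_)
  obtain ⟨e, ⟨heR, -⟩, rfl⟩ := mem_iteratedComparisonVector.1 hy
  exact hwin e heR

end LOICV

end SchoolChoice

theorem mainTheorem3 {N M F : Type*} [Fintype N] [Fintype M] [Fintype F]
    (hF : Fintype.card F = 2) (next : SchoolChoice.NextRule N M F)
    (hnext : SchoolChoice.IsLOICV next) :
    SchoolChoice.IsICR (SchoolChoice.GDA next) :=
  SchoolChoice.isICR_GDA_of_isCondorcet (hnext.isCondorcet hF)
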